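/- \textbf{Setting.} Let $\mathbb M=\{\pm e_1,\pm e_2\}\subset\mathbb R^2$. A configuration is a locally finite set $\varphi\subset\mathbb R^2\times\mathbb M$; configurations carry the $\sigma$-algebra generated by the numbers of points in bounded measurable sets, and an event is a measurable set of configurations. Put $Q_r(o)=[-r/2,r/2]^2$, $Q_r(\zeta)=\zeta+Q_r(o)$, $Q_r^{\mathbb M}(o)=Q_r(o)\times\mathbb M$ and $\varphi-\zeta=\{(\xi-\zeta,v):(\xi,v)\in\varphi\}$. \textbf{Lilypond model.} A function $f:\varphi\to[0,\infty]$ is a lilypond length function of $\varphi$ if (i) the segments $[\xi,\xi+f(x)v)$, $x=(\xi,v)\in\varphi$, are pairwise disjoint, and (ii) for every $x=(\xi,v)\in\varphi$ with $f(x)<\infty$ there is a unique $y=(\eta,w)\in\varphi$ with $\xi+f(x)v\in[\eta,\eta+f(y)w)$ and $|\xi+f(x)v-\eta|<f(x)$. Let $\mathbf N'$ be the family of all non-empty configurations $\varphi$ such that: no infinite sequence $(\xi_i)_{i\ge1}$ of locations of points of $\varphi$ satisfies $|\xi_{i}-\xi_{i+1}|_\infty<|\xi_{i-1}-\xi_{i}|_\infty$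 for all $i\ge2$; no two distinct points of $\varphi$ have locations that differ by a multiple of $e_1$, $e_2$, $e_1+e_2$ or $e_1-e_2$; and $\varphi$ has a lilypond length function $f$ (which is then unique), with only finite values. For $\varphi\in\mathbf N'$ and $x=(\xi,v)\in\varphi$ let $h_{\mathsf c}(\varphi,x)\in\varphi$ be the point $y=(\eta,w)$ in (ii), let $h_{\mathsf g}(\varphi,x)$ be the intersection point of $\xi+[0,\infty)v$ and $\eta+[0,\infty)w$ (this is $\xi+f(x)v$), and put $I(\varphi,x)=[\xi,h_{\mathsf g}(\varphi,x)]$. \textbf{Poisson input.} Let $\lambda>0$ and, for $s>1$, let $X^{(1)}=X^{(1)}(s)$ be an independently and uniformly $\mathbb M$-marked homogeneous Poisson point process in $\mathbb R^2$ with intensity $\lambda(1-s^{-3})$. \textbf{Shielding condition (SH)} for a family of events $(A_s)_{s\ge1}$. Consider $\mathbb Z^2$ with edges $\{z_1,z_2\}$, $|z_1-z_2|_\infty\le1$, $z_1\neq z_2$. Let $s\ge1$ and let $B,B'\subset\mathbb Z^2$ be finite and disjoint, such that no vertex of $B$ lies in an infinite connected component of $\mathbb Z^2\setminus B'$. Let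 $\widehat B\supset B$ be the union of the connected components of $\mathbb Z^2\setminus B'$ that meet $B$. If $\varphi\in\mathbf N'$ is such that $(\varphi-sz')\cap Q^{\mathbb M}_{3s}(o)\in A_s$ for all $z'\in B'$, then $$\{\xi,\,h_{\mathsf g}(\varphi,h_{\mathsf c}(\varphi,x))\}\subset\bigcup_{z\in\widehat B\cup B'}Q_s(sz)$$ for all $x=(\xi,v)\in\varphi$ with $h_{\mathsf g}(\varphi,x)\in\bigcup_{z\in B}Q_s(sz)$. \textbf{Statement.} For every $\alpha>0$ there is a family of events $(A^{(5,\alpha)}_s)_{s\ge1}$ with the following properties. 1. $\lim_{s\to\infty}\mathbb P\big(X^{(1)}(s)\cap Q_s^{\mathbb M}(o)\in A^{(5,\alpha)}_s\big)=1$. 2. Let $s\ge1$, let $\varphi\subset Q_s^{\mathbb M}(o)$ be a configuration with $\varphi\in A_s^{(5,\alpha)}$, and let $\psi\subset(\mathbb R^2\times\mathbb M)\setminus Q_s^{\mathbb M}(o)$ be locally finite with $\varphi\cup\psi\in\mathbf N'$. Then for every $x\in\varphi\cup\psi$ the one-dimensional Hausdorff measure satisfies $\nu_1\big(I(\varphi\cup\psi,x)\cap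 Q_s(o)\big)\le s^\alpha$. 3. If $\alpha<1/2$, then the sets $A_s=\{\varphi:\varphi\cap Q_s^{\mathbb M}(o)\in A_s^{(5,\alpha)}\}$ are events, $\lim_{s\to\infty}\mathbb P\big(X^{(1)}(s)\cap Q_{3s}^{\mathbb M}(o)\in A_s\big)=1$, and $(A_s)_{s\ge1}$ satisfies (SH). -/

import Mathlib

open MeasureTheory Filter Topology Set
open scoped ENNReal NNReal

universe u

noncomputable section

/-! ### Marked configurations in `ℝ^d × M` -/

/-- Marked points.  The norm of `Fin d → ℝ` is the maximum norm `|·|_∞`. -/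
abbrev MPoint (d : ℕ) (M : Type) : Type := (Fin d → ℝ) × M

/-- The closed box `Q_r(o) = [-r/2, r/2]^d`. -/
def box (d : ℕ) (r : ℝ) : Set (Fin d → ℝ) := {ξ | ∀ i, |ξ i| ≤ r / 2}

/-- The marked box `Q_r(o) × M`. -/
def markedBox (d : ℕ) (M : Type) (r : ℝ) : Set (MPoint d M) := {x | x.1 ∈ box d r}

/-- Locally finite subsets of `ℝ^d × M`. -/
@[ext] structure Config (d : ℕ) (M : Type) where
  carrier : Set (MPoint d M)
  locallyFinite : ∀ r : ℝ, (carrier ∩ markedBox d M r).Finite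

namespace Config

variable {d : ℕ} {M : Type}

/-- `φ ∩ S`. -/
def restrict (φ : Config d M) (S : Set (MPoint d M)) : Config d M where
  carrier := φ.carrier ∩ S
  locallyFinite r := (φ.locallyFinite r).subset fun _ hx => ⟨hx.1.1, hx.2⟩

/-- `φ ∪ ψ`. -/
def union (φ ψ : Config d M) : Config d M where
  carrier := φ.carrier ∪ ψ.carrier
  locallyFinite r := by
    rw [Set.union_inter_distrib_right]
    exact (φ.locallyFinite r).union (ψ.locallyFinite r)

/-- `φ - η = {(ξ - η, m) : (ξ, m) ∈ φ}`. -/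
def shift (φ : Config d M) (η : Fin d → ℝ) : Config d M where
  carrier := (fun x : MPoint d M => (x.1 - η, x.2)) '' φ.carrier
  locallyFinite r := by
    refine ((φ.locallyFinite (r + 2 * ‖η‖)).image
      (fun x : MPoint d M => (x.1 - η, x.2))).subset ?_
    rintro _ ⟨⟨x, hx, rfl⟩, hb⟩
    refine ⟨x, ⟨hx, fun i => ?_⟩, rfl⟩
    have h1 : |x.1 i - η i| ≤ r / 2 := hb i
    have h2 : |η i| ≤ ‖η‖ := norm_le_pi_norm η i
    have h3 : |x.1 i| ≤ |x.1 i - η i| + |η i| := by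
      simpa using abs_add_le (x.1 i - η i) (η i)
    linarith

/-- The number of points in `B`; only used for bounded `B`, where this number is finite. -/
def count (B : Set (MPoint d M)) (φ : Config d M) : ℕ := (φ.carrier ∩ B).ncard

/-- The usual `σ`-algebra on configurations, generated by the numbers of points in bounded
measurable sets. -/
instance [MeasurableSpace M] : MeasurableSpace (Config d M) :=
  ⨆ (B : Set (MPoint d M)) (_ : MeasurableSet B) (_ : ∃ r, B ⊆ markedBox d M r),
    MeasurableSpace.comap (count B) ⊤

end Config

/-- `X` is an independently marked homogeneous Poisson point process on `ℝ^d` with intensity `lam`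
and mark distribution `ν`, i.e. a Poisson point process on `ℝ^d × M` whose intensity measure is
`lam · Lebesgue ⊗ ν`. -/
structure IsMarkedPoisson {d : ℕ} {M : Type} [MeasurableSpace M] {Ω : Type*} [MeasurableSpace Ω]
    (P : Measure Ω) (X : Ω → Config d M) (lam : ℝ) (ν : Measure M) : Prop where
  measurable : Measurable X
  poisson : ∀ B : Set (MPoint d M), MeasurableSet B → (∃ r, B ⊆ markedBox d M r) →
    P.map (fun ω => (X ω).count B) = ProbabilityTheory.poissonMeasure
      (((ENNReal.ofReal lam • (volume : Measure (Fin d → ℝ))).prod ν) B).toNNReal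
  indep : ∀ (n : ℕ) (B : Fin n → Set (MPoint d M)), (∀ i, MeasurableSet (B i)) →
    (∀ i, ∃ r, B i ⊆ markedBox d M r) → Pairwise (fun i j => Disjoint (B i) (B j)) →
    ProbabilityTheory.iIndepFun (fun i ω => (X ω).count (B i)) P

/-! ### The shielding condition -/

/-- The lattice `ℤ^d` with edges `{z₁, z₂}`, `|z₁ - z₂|_∞ ≤ 1`. -/
def latticeGraph (d : ℕ) : SimpleGraph (Fin d → ℤ) where
  Adj z w := z ≠ w ∧ ∀ i, |z i - w i| ≤ 1
  symm := ⟨fun z w h => ⟨h.1.symm, fun i => by rw [abs_sub_comm]; exact h.2 i⟩⟩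
  loopless := ⟨fun _ h => h.1 rfl⟩

/-- The union of those connected components of `ℤ^d \ B'` that meet `B`. -/
def hull {d : ℕ} (B B' : Set (Fin d → ℤ)) : Set (Fin d → ℤ) :=
  {z | ∃ (c : ((latticeGraph d).induce B'ᶜ).ConnectedComponent), ∃ b ∈ c.supp, ∃ a ∈ c.supp,
    (b : Fin d → ℤ) ∈ B ∧ (a : Fin d → ℤ) = z}

/-- The point `s z ∈ ℝ^d` for `z ∈ ℤ^d`. -/
def latticePoint {d : ℕ} (s : ℝ) (z : Fin d → ℤ) : Fin d → ℝ := fun i => s * (z i : ℝ)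

/-- The union of the boxes `Q_s(sz) = sz + Q_s(o)`, `z ∈ B`. -/
def blocks {d : ℕ} (s : ℝ) (B : Set (Fin d → ℤ)) : Set (Fin d → ℝ) :=
  {ξ | ∃ z ∈ B, ξ - latticePoint s z ∈ box d s}

/-- The shielding condition (SH) for the directed graph on configurations in `N'` with combinatorial
descendants `hc` and geometric descendants `hg`, and for the family of events `A`. -/
def ShieldingCondition {d : ℕ} {M : Type} (N' : Set (Config d M))
    (hc : Config d M → MPoint d M → MPoint d M) (hg : Config d M → MPoint d M → (Fin d → ℝ))
    (A : ℝ → Set (Config d M)) : Prop :=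
  ∀ s : ℝ, 1 ≤ s → ∀ B B' : Set (Fin d → ℤ), B.Finite → B'.Finite → Disjoint B B' →
    -- no vertex of `B` lies in an infinite connected component of `ℤ^d \ B'`
    (∀ c : ((latticeGraph d).induce B'ᶜ).ConnectedComponent, c.supp.Infinite →
      ∀ z ∈ c.supp, (z : Fin d → ℤ) ∉ B) →
    ∀ φ ∈ N',
      (∀ z ∈ B', (φ.shift (latticePoint s z)).restrict (markedBox d M (3 * s)) ∈ A s) →
      ∀ x ∈ φ.carrier, hg φ x ∈ blocks s B →
        x.1 ∈ blocks s (hull B B' ∪ B') ∧ hg φ (hc φ x) ∈ blocks s (hull B B' ∪ B')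

/-! ### The anisotropic line-segment lilypond model -/

/-- The four directions: `(i, true)` stands for `e_i` and `(i, false)` for `-e_i`. -/
abbrev Dir : Type := Fin 2 × Bool

/-- The unit vector of a direction. -/
def Dir.vec (v : Dir) : Fin 2 → ℝ := if v.2 then Pi.single v.1 1 else -Pi.single v.1 1

/-- The half-open segment `[ξ, ξ + r v)`, where `r ∈ [0, ∞]`. -/
def halfOpenSegment (x : MPoint 2 Dir) (r : ℝ≥0∞) : Set (Fin 2 → ℝ) :=
  {p | ∃ t : ℝ, 0 ≤ t ∧ ENNReal.ofReal t < r ∧ p = x.1 + t • x.2.vec}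

/-- The ray `ξ + [0, ∞) v`. -/
def ray (x : MPoint 2 Dir) : Set (Fin 2 → ℝ) := {p | ∃ t : ℝ, 0 ≤ t ∧ p = x.1 + t • x.2.vec}

/-- `y` is a stopping neighbor of `x` when the lengths of the segments are given by `f`.
The distance is measured along the axis-parallel segment of `y`, so that the Euclidean and the
maximum distance agree. -/
def IsStoppingNeighbor (f : MPoint 2 Dir → ℝ≥0∞) (x y : MPoint 2 Dir) : Prop :=
  x.1 + (f x).toReal • x.2.vec ∈ halfOpenSegment y (f y) ∧
    dist (x.1 + (f x).toReal • x.2.vec) y.1 < (f x).toReal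

/-- The lengths `f` (relevant only on `φ`) satisfy the two defining properties of the lilypond
model on `φ`. -/
structure IsLilypond (φ : Config 2 Dir) (f : MPoint 2 Dir → ℝ≥0∞) : Prop where
  hardCore : ∀ x ∈ φ.carrier, ∀ y ∈ φ.carrier, x ≠ y →
    Disjoint (halfOpenSegment x (f x)) (halfOpenSegment y (f y))
  stopping : ∀ x ∈ φ.carrier, f x < ⊤ → ∃! y, y ∈ φ.carrier ∧ IsStoppingNeighbor f x y

/-- The sequence `ξ` is an infinite `b`-bounded anisotropic descending chain of `φ`. -/
def IsDescendingChain (φ : Config 2 Dir) (b : ℝ) (ξ : ℕ → (Fin 2 → ℝ)) : Prop :=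
  (∀ i, ∃ v, (ξ i, v) ∈ φ.carrier) ∧ ‖ξ 0 - ξ 1‖ ≤ b ∧
    ∀ i, ‖ξ (i + 1) - ξ (i + 2)‖ < ‖ξ i - ξ (i + 1)‖

/-- No two points of `φ` differ by a multiple of `e₁`, `e₂`, `e₁ + e₂` or `e₁ - e₂`. -/
def IsGeneric (φ : Config 2 Dir) : Prop :=
  ∀ x ∈ φ.carrier, ∀ y ∈ φ.carrier, x ≠ y →
    x.1 0 ≠ y.1 0 ∧ x.1 1 ≠ y.1 1 ∧ |x.1 0 - y.1 0| ≠ |x.1 1 - y.1 1|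

/-- The length function of the lilypond model on `φ`; its values at the points of `φ` are uniquely
determined, see `IsLilypond.eq_of_mem`. -/
def lilyLength (φ : Config 2 Dir) : MPoint 2 Dir → ℝ≥0∞ :=
  Classical.epsilon fun f => IsLilypond φ f

/-- The family `N'` on which the lilypond model is considered. -/
def lilyConfigs : Set (Config 2 Dir) :=
  {φ | φ.carrier.Nonempty ∧ (¬ ∃ b > 0, ∃ ξ, IsDescendingChain φ b ξ) ∧ IsGeneric φ ∧
    (∃ f, IsLilypond φ f) ∧ ∀ x ∈ φ.carrier, lilyLength φ x < ⊤}

/-- The combinatorial descendant: the stopping neighbor. -/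
def combDesc (φ : Config 2 Dir) (x : MPoint 2 Dir) : MPoint 2 Dir :=
  Classical.epsilon fun y => y ∈ φ.carrier ∧ IsStoppingNeighbor (lilyLength φ) x y

/-- The geometric descendant: the intersection point of the rays of `x` and of its combinatorial
descendant, see `ray_inter_ray`. -/
def geomDesc (φ : Config 2 Dir) (x : MPoint 2 Dir) : Fin 2 → ℝ :=
  Classical.epsilon fun p => p ∈ ray x ∩ ray (combDesc φ x)

/-- The segment `I(φ, x) = [ξ, h_g(φ, x)]`. -/
def lilySegment (φ : Config 2 Dir) (x : MPoint 2 Dir) : Set (Fin 2 → ℝ) :=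
  segment ℝ x.1 (geomDesc φ x)

/-- The uniform distribution on the four directions. -/
def uniformDir : Measure Dir := ProbabilityTheory.uniformOn Set.univ

/-- Let `X₁ s` be the thinned process, an independently and uniformly marked homogeneous planar
Poisson process of intensity `lam (1 - s⁻³)`, for `s > 1`.  Then the probability that
`X₁ s ∩ (Q_{c s}(o) × M)` is in `A s` tends to `1` as `s → ∞`. -/
def HighProbability (lam c : ℝ) (A : ℝ → Set (Config 2 Dir)) : Prop :=
  ∀ (Ω : Type u) [MeasurableSpace Ω] (P : Measure Ω) [IsProbabilityMeasure P]
    (X₁ : ℝ → Ω → Config 2 Dir),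
    (∀ s > 1, IsMarkedPoisson P (X₁ s) (lam * (1 - (s ^ 3)⁻¹)) uniformDir) →
    Tendsto (fun s => P {ω | (X₁ s ω).restrict (markedBox 2 Dir (c * s)) ∈ A s}) atTop (𝓝 1)

/-! ### The definitions by choice are well-posed -/

lemma Dir.norm_smul_vec (v : Dir) (t : ℝ) : ‖t • v.vec‖ = |t| := by
  have : ‖v.vec‖ = 1 := by
    unfold Dir.vec
    split <;> simp [Pi.norm_single]
  rw [norm_smul, this, mul_one, Real.norm_eq_abs]

lemma Dir.vec_apply (v : Dir) (i : Fin 2) :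
    v.vec i = if i = v.1 then (if v.2 then 1 else -1) else 0 := by
  unfold Dir.vec
  split <;> simp [Pi.single_apply, apply_ite]

/-- In generic position, stopping neighbors grow in orthogonal directions and their distance is the
length of the stopped segment. -/
lemma IsStoppingNeighbor.geometry {φ : Config 2 Dir} (hφ : IsGeneric φ)
    {f : MPoint 2 Dir → ℝ≥0∞} {x y : MPoint 2 Dir} (hx : x ∈ φ.carrier) (hy : y ∈ φ.carrier)
    (h : IsStoppingNeighbor f x y) :
    x.2.1 ≠ y.2.1 ∧ ‖x.1 - y.1‖ = (f x).toReal := by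
  obtain ⟨⟨t, ht, -, hp⟩, hd⟩ := h
  have hne : x ≠ y := by
    rintro rfl
    rw [dist_eq_norm, add_sub_cancel_left, Dir.norm_smul_vec, abs_of_nonneg ENNReal.toReal_nonneg]
      at hd
    exact lt_irrefl _ hd
  obtain ⟨g0, g1, -⟩ := hφ x hx y hy hne
  rw [hp, dist_eq_norm, add_sub_cancel_left, Dir.norm_smul_vec, abs_of_nonneg ht] at hd
  set r := (f x).toReal with hr
  have hr0 : 0 ≤ r := ENNReal.toReal_nonneg
  have e0 := congrFun hp 0
  have e1 := congrFun hp 1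
  obtain ⟨ξ, i, b⟩ := x
  obtain ⟨η, j, c⟩ := y
  simp only [Pi.add_apply, Pi.smul_apply, smul_eq_mul, Dir.vec_apply] at e0 e1 g0 g1 ⊢
  have key : i ≠ j := by
    rintro rfl
    fin_cases i
    · simp at e1; exact g1 e1
    · simp at e0; exact g0 e0
  refine ⟨key, le_antisymm ?_ ?_⟩
  · rw [pi_norm_le_iff_of_nonneg hr0]
    intro k
    rw [Real.norm_eq_abs, abs_le, Pi.sub_apply]
    fin_cases i <;> fin_cases j <;> fin_cases k <;> simp at key e0 e1 ⊢ <;>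
      cases b <;> cases c <;> simp at e0 e1 <;> constructor <;> linarith
  · have := norm_le_pi_norm (ξ - η) i
    refine le_trans ?_ this
    rw [Real.norm_eq_abs, le_abs, Pi.sub_apply]
    fin_cases i <;> fin_cases j <;> simp at key e0 e1 ⊢ <;>
      cases b <;> cases c <;> simp at e0 e1 <;>
      first
        | (left; linarith)
        | (right; linarith)

/-- The lengths are uniquely determined if there are no infinite descending chains. -/
theorem IsLilypond.eq_of_mem {φ : Config 2 Dir} (hφ : IsGeneric φ)
    (hc : ¬ ∃ b > 0, ∃ ξ, IsDescendingChain φ b ξ) {f g : MPoint 2 Dir → ℝ≥0∞}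
    (hf : IsLilypond φ f) (hg : IsLilypond φ g) {x : MPoint 2 Dir} (hx : x ∈ φ.carrier) :
    f x = g x := by
  by_contra hne
  have half : ∀ f g : MPoint 2 Dir → ℝ≥0∞, IsLilypond φ f → IsLilypond φ g →
      ∀ x ∈ φ.carrier, f x < g x → ∃ y ∈ φ.carrier, g y < f y ∧ g y < f x ∧
        ‖x.1 - y.1‖ = (f x).toReal := by
    intro f g hf hg x hx hlt
    have hfin : f x < ⊤ := lt_of_lt_of_le hlt le_top
    obtain ⟨y, ⟨hy, hs⟩, -⟩ := hf.stopping x hx hfin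
    have hgeo := hs.geometry hφ hx hy
    obtain ⟨⟨t, ht, htf, hp⟩, hd⟩ := hs
    have hxy : x ≠ y := by
      rintro rfl
      exact hgeo.1 rfl
    have hle : g y ≤ ENNReal.ofReal t := by
      by_contra hcon
      rw [not_le] at hcon
      refine Set.disjoint_left.1 (hg.hardCore x hx y hy hxy)
        ⟨(f x).toReal, ENNReal.toReal_nonneg, ?_, rfl⟩ ⟨t, ht, hcon, hp⟩
      rwa [ENNReal.ofReal_toReal hfin.ne]
    rw [hp, dist_eq_norm, add_sub_cancel_left, Dir.norm_smul_vec, abs_of_nonneg ht] at hd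
    refine ⟨y, hy, hle.trans_lt htf, hle.trans_lt ?_, hgeo.2⟩
    exact (ENNReal.ofReal_lt_iff_lt_toReal ht hfin.ne).2 hd
  let S := {x : MPoint 2 Dir // x ∈ φ.carrier ∧ f x ≠ g x}
  have step : ∀ x : S, ∃ y : S, min (f y) (g y) < min (f x) (g x) ∧ min (f x) (g x) < ⊤ ∧
      ‖x.1.1 - y.1.1‖ = (min (f x) (g x)).toReal := by
    rintro ⟨x, hx, hne⟩
    rcases lt_or_gt_of_ne hne with h | h
    · obtain ⟨y, hy, h1, h2, h3⟩ := half f g hf hg x hx h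
      refine ⟨⟨y, hy, h1.ne'⟩, ?_, ?_, ?_⟩
      · simpa [min_eq_left h.le, min_eq_right h1.le] using h2
      · simpa [min_eq_left h.le] using h.trans_le le_top
      · simpa [min_eq_left h.le] using h3
    · obtain ⟨y, hy, h1, h2, h3⟩ := half g f hg hf x hx h
      refine ⟨⟨y, hy, h1.ne⟩, ?_, ?_, ?_⟩
      · simpa [min_eq_right h.le, min_eq_left h1.le] using h2
      · simpa [min_eq_right h.le] using h.trans_le le_top
      · simpa [min_eq_right h.le] using h3
  choose nxt hn1 hn2 hn3 using step
  let z : ℕ → S := fun n => nxt^[n] ⟨x, hx, hne⟩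
  have hz : ∀ n, z (n + 1) = nxt (z n) := fun n => Function.iterate_succ_apply' nxt n _
  refine hc ⟨‖(z 0).1.1 - (z 1).1.1‖ + 1, by positivity, fun n => (z n).1.1,
    fun i => ⟨(z i).1.2, (z i).2.1⟩, by linarith, fun i => ?_⟩
  show ‖(z (i + 1)).1.1 - (z (i + 1 + 1)).1.1‖ < ‖(z i).1.1 - (z (i + 1)).1.1‖
  rw [hz (i + 1), hn3, hz i, hn3]
  exact ENNReal.toReal_strict_mono (hn2 _).ne (hn1 _)

theorem isLilypond_lilyLength {φ : Config 2 Dir} (hφ : φ ∈ lilyConfigs) :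
    IsLilypond φ (lilyLength φ) :=
  Classical.epsilon_spec hφ.2.2.2.1

theorem combDesc_spec {φ : Config 2 Dir} (hφ : φ ∈ lilyConfigs) {x : MPoint 2 Dir}
    (hx : x ∈ φ.carrier) :
    combDesc φ x ∈ φ.carrier ∧ IsStoppingNeighbor (lilyLength φ) x (combDesc φ x) :=
  Classical.epsilon_spec
    ((isLilypond_lilyLength hφ).stopping x hx (hφ.2.2.2.2 x hx)).exists

/-- The two rays meet in exactly one point, the endpoint of the segment of `x`. -/
theorem ray_inter_ray {φ : Config 2 Dir} (hφ : φ ∈ lilyConfigs) {x : MPoint 2 Dir}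
    (hx : x ∈ φ.carrier) :
    ray x ∩ ray (combDesc φ x) = {x.1 + (lilyLength φ x).toReal • x.2.vec} := by
  obtain ⟨hy, hs⟩ := combDesc_spec hφ hx
  have hgeo := (hs.geometry hφ.2.2.1 hx hy).1
  obtain ⟨t, ht, -, hp⟩ := hs.1
  refine Set.Subset.antisymm ?_ ?_
  · rintro p ⟨⟨a, ha, rfl⟩, ⟨b, hb, hab⟩⟩
    rw [Set.mem_singleton_iff]
    have e := congrFun hp x.2.1
    have e' := congrFun hab x.2.1
    simp only [Pi.add_apply, Pi.smul_apply, smul_eq_mul, Dir.vec_apply, if_neg hgeo, if_true,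
      mul_zero] at e e'
    have : a = (lilyLength φ x).toReal := by
      split_ifs at e e' <;> linarith
    rw [this]
  · rintro p rfl
    exact ⟨⟨_, ENNReal.toReal_nonneg, rfl⟩, ⟨t, ht, hp⟩⟩

theorem geomDesc_eq {φ : Config 2 Dir} (hφ : φ ∈ lilyConfigs) {x : MPoint 2 Dir}
    (hx : x ∈ φ.carrier) :
    geomDesc φ x = x.1 + (lilyLength φ x).toReal • x.2.vec := by
  have h : geomDesc φ x ∈ ray x ∩ ray (combDesc φ x) :=
    Classical.epsilon_spec (p := fun p => p ∈ ray x ∩ ray (combDesc φ x))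
      ⟨_, by rw [ray_inter_ray hφ hx]; rfl⟩
  rwa [ray_inter_ray hφ hx] at h

end

noncomputable section

/-! ### Barriers -/

/-! A long segment is impossible if its line is cut often enough by another segment. Suppose a
segment parallel to the axis `i` runs at signed height `h` above the centre of a box. A barrier in a
cell below it is a point marked orthogonally to `i`, pointing outward towards `h`, such that no
point of the other axis lies close enough to stop it before it reaches height `h`. This can be read
off from the points in a small rectangle: in generic position a stopping neighbor lies at maximum
distance exactly equal to the stopped length (`IsStoppingNeighbor.geometry`). If the long segment
passed over such a cell, the two segments would meet, against the hard-core property. Thus, if each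
window of about `L / 12` consecutive cells contains a barrier, no segment covers a length above `L`
inside the box, whatever the configuration is outside (`length_le_of_barrierEvent`).

Different cells use disjoint regions, and core and shadow carry marks of different axes. Hence
barriers occur independently, each with probability at least `barrierProb lam`. A window without
barriers has probability at most `(1 - p) ^ windowSize L` with `p = barrierProb lam`. For `L = s ^
α` this beats the number of windows, which is of order `s ^ 2` (`tendsto_measure_barrierEvent`).

Shielding follows from `s ^ α < s`: an axis-parallel segment entering a block of `B'` through a face
cannot reach the opposite face, so a path that starts in the hull of `B` ends in the hull or in `B'`
(`mem_blocks_of_path`). It is applied to the segment of `x` run backwards and to the rest of the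
segment of its stopping neighbor. -/

/-- The sign of a direction. -/
def Dir.sgn (v : Dir) : ℝ := if v.2 then 1 else -1

lemma Dir.sgn_mul_self (v : Dir) : v.sgn * v.sgn = 1 := by
  unfold Dir.sgn; split <;> norm_num

lemma Dir.vec_axis (v : Dir) : v.vec v.1 = v.sgn := by
  simp [Dir.vec_apply, Dir.sgn]

lemma Dir.vec_of_ne {v : Dir} {i : Fin 2} (h : i ≠ v.1) : v.vec i = 0 := by
  simp [Dir.vec_apply, h]

lemma Fin.one_sub_ne (j : Fin 2) : 1 - j ≠ j := by
  revert j; decide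

lemma Fin.eq_one_sub_of_ne {i j : Fin 2} (h : i ≠ j) : i = 1 - j := by
  revert i j; decide

lemma Fin.one_sub_one_sub (j : Fin 2) : 1 - (1 - j) = j := by
  revert j; decide

/-- The points of direction `v` in a rectangle at height at most `k`, centred above `6 m`. -/
def barrierCore (v : Dir) (m : ℤ) (k : ℕ) : Set (MPoint 2 Dir) :=
  {x | x.2 = v ∧ |x.1 (1 - v.1) - 6 * m| ≤ 1 / 2 ∧ k - 1 ≤ v.sgn * x.1 v.1 ∧ v.sgn * x.1 v.1 ≤ k}

/-- The points which could stop the segment of a point of `barrierCore v m k` before it reaches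
height `k + 1`. -/
def barrierShadow (v : Dir) (m : ℤ) (k : ℕ) : Set (MPoint 2 Dir) :=
  {x | x.2.1 ≠ v.1 ∧ |x.1 (1 - v.1) - 6 * m| ≤ 5 / 2 ∧
    k - 1 ≤ v.sgn * x.1 v.1 ∧ v.sgn * x.1 v.1 ≤ k + 1}

/-- The number of cells in a window of length `L`. -/
def windowSize (L : ℝ) : ℕ := ⌊L / 12⌋₊

/-- All cells of the window starting at `m` lie in the box of side length `s`. -/
def WindowInBox (s L : ℝ) (m : ℤ) : Prop :=
  -(s / 2) ≤ 6 * ((m : ℝ) + 2) - 5 / 2 ∧ 6 * ((m : ℝ) + 1 + windowSize L) + 5 / 2 ≤ s / 2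

/-- The configuration has a barrier in a cell. -/
def HasBarrier (s : ℝ) (v : Dir) (m : ℤ) (k : ℕ) (φ : Config 2 Dir) : Prop :=
  φ.count (barrierCore v m k ∩ markedBox 2 Dir s) ≠ 0 ∧
    φ.count (barrierShadow v m k ∩ markedBox 2 Dir s) = 0

/-- Every window of length `L` in the box of side length `s` contains a barrier. -/
def barrierEvent (s L : ℝ) : Set (Config 2 Dir) :=
  {φ | 2 ≤ s ∧ 18 ≤ L ∧ ∀ (v : Dir) (m : ℤ) (k : ℕ), WindowInBox s L m → (k : ℝ) ≤ s / 2 →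
    ∃ q : Fin (windowSize L), HasBarrier s v (m + 2 + (q : ℕ)) k φ}

/-! ### Locality of the barrier event and its effect on segment lengths -/

lemma Config.count_restrict {d : ℕ} {M : Type} (φ : Config d M) (B S : Set (MPoint d M)) :
    (φ.restrict S).count B = φ.count (B ∩ S) := by
  simp only [Config.count, Config.restrict, Set.inter_assoc, Set.inter_comm S B]

/-- All counts in the event are taken inside the box of side `s`. So one event serves for the boxes
of side `s` and `3 s`, and also as its own restriction. -/
lemma restrict_mem_barrierEvent {s r L : ℝ} (hr : s ≤ r) (φ : Config 2 Dir) :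
    φ.restrict (markedBox 2 Dir r) ∈ barrierEvent s L ↔ φ ∈ barrierEvent s L := by
  have h : markedBox 2 Dir s ∩ markedBox 2 Dir r = markedBox 2 Dir s :=
    Set.inter_eq_left.2 fun x hx i => (hx i).trans (by linarith)
  simp only [barrierEvent, HasBarrier, Set.mem_ofPred_eq, Config.count_restrict, Set.inter_assoc, h]

lemma HasBarrier.exists_mem {s : ℝ} {v : Dir} {m : ℤ} {k : ℕ} {φ : Config 2 Dir}
    (h : HasBarrier s v m k φ) :
    ∃ y ∈ φ.carrier, y ∈ barrierCore v m k ∧ y ∈ markedBox 2 Dir s := by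
  obtain ⟨y, hy, h1, h2⟩ := Set.nonempty_of_ncard_ne_zero h.1
  exact ⟨y, hy, h1, h2⟩

lemma HasBarrier.notMem_shadow {s : ℝ} {v : Dir} {m : ℤ} {k : ℕ} {φ : Config 2 Dir}
    (h : HasBarrier s v m k φ) {z : MPoint 2 Dir} (hz : z ∈ φ.carrier)
    (hs : z ∈ markedBox 2 Dir s) : z ∉ barrierShadow v m k := by
  intro hm
  -- `ncard` vanishes on infinite sets too; local finiteness excludes this default value.
  have hfin : (φ.carrier ∩ (barrierShadow v m k ∩ markedBox 2 Dir s)).Finite :=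
    (φ.locallyFinite s).subset fun x hx => ⟨hx.1, hx.2.2⟩
  have := (Set.ncard_eq_zero hfin).1 h.2
  exact (this ▸ (⟨hz, hm, hs⟩ : z ∈ φ.carrier ∩ (barrierShadow v m k ∩ markedBox 2 Dir s)) :
    z ∈ (∅ : Set _))

/-- A point of a core grows beyond height `d` if the shadow is empty. -/
lemma lt_length_of_shadow_empty {φ : Config 2 Dir} {f : MPoint 2 Dir → ℝ≥0∞}
    (hg : IsGeneric φ) (hf : IsLilypond φ f) {y : MPoint 2 Dir} (hy : y ∈ φ.carrier) {d : ℝ}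
    (hd : 0 ≤ d)
    (hz : ∀ z ∈ φ.carrier, z.2.1 ≠ y.2.1 → |z.1 (1 - y.2.1) - y.1 (1 - y.2.1)| ≤ d →
      y.2.sgn * y.1 y.2.1 ≤ y.2.sgn * z.1 y.2.1 →
      y.2.sgn * z.1 y.2.1 ≤ y.2.sgn * y.1 y.2.1 + d → False) :
    ENNReal.ofReal d < f y := by
  by_contra hcon
  rw [not_lt] at hcon
  have hfin : f y < ⊤ := hcon.trans_lt ENNReal.ofReal_lt_top
  have hr : (f y).toReal ≤ d := ENNReal.toReal_le_of_le_ofReal hd hcon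
  obtain ⟨z, ⟨hzφ, hs⟩, -⟩ := hf.stopping y hy hfin
  obtain ⟨hax, hnorm⟩ := hs.geometry hg hy hzφ
  obtain ⟨⟨t, -, -, hp⟩, -⟩ := hs
  have e := congrFun hp y.2.1
  simp only [Pi.add_apply, Pi.smul_apply, smul_eq_mul, Dir.vec_axis, Dir.vec_of_ne hax,
    mul_zero, add_zero] at e
  have h0 : (0 : ℝ) ≤ (f y).toReal := ENNReal.toReal_nonneg
  -- The segment of `z` is orthogonal to that of `y`, so `z` has the same height as the endpoint of
  -- `y`. Its lateral offset is at most the length of `y`, by `hnorm`.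
  have e' : y.2.sgn * z.1 y.2.1 = y.2.sgn * y.1 y.2.1 + (f y).toReal := by
    rw [← e, mul_add, mul_left_comm, Dir.sgn_mul_self, mul_one]
  have hn := norm_le_pi_norm (y.1 - z.1) (1 - y.2.1)
  rw [hnorm, Pi.sub_apply, Real.norm_eq_abs, abs_sub_comm] at hn
  exact hz z hzφ hax.symm (hn.trans hr) (by linarith) (by linarith)

/-- In a box which satisfies the barrier event, all segments have length at most `L`. -/
theorem length_le_of_barrierEvent {φ ω : Config 2 Dir} {f : MPoint 2 Dir → ℝ≥0∞}
    (hg : IsGeneric φ) (hf : IsLilypond φ f) {s L : ℝ} (hω : ω ∈ barrierEvent s L)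
    (c : Fin 2 → ℝ)
    (hφω : ∀ z : MPoint 2 Dir, z.1 - c ∈ box 2 s → (z ∈ φ.carrier ↔ (z.1 - c, z.2) ∈ ω.carrier))
    {x : MPoint 2 Dir} (hx : x ∈ φ.carrier) {t₁ t₂ : ℝ} (ht₁ : 0 ≤ t₁)
    (ht₂ : ENNReal.ofReal t₂ ≤ f x)
    (hb₁ : x.1 + t₁ • x.2.vec - c ∈ box 2 s) (hb₂ : x.1 + t₂ • x.2.vec - c ∈ box 2 s) :
    t₂ - t₁ ≤ L := by
  by_contra! hlt
  obtain ⟨hs2, hL, hev⟩ := hω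
  obtain ⟨ξ, u⟩ := x
  set i : Fin 2 := u.1 with hi
  set j : Fin 2 := 1 - i with hj
  have hji : j ≠ i := Fin.one_sub_ne i
  have hij : 1 - j = i := Fin.one_sub_one_sub i
  -- coordinates of the end points
  have b1i := hb₁ i
  have b2i := hb₂ i
  have b1j := hb₁ j
  simp only [Pi.sub_apply, Pi.add_apply, Pi.smul_apply, smul_eq_mul, hi, Dir.vec_axis] at b1i b2i
  simp only [Pi.sub_apply, Pi.add_apply, Pi.smul_apply, smul_eq_mul,
    Dir.vec_of_ne (v := u) hji, mul_zero, add_zero] at b1j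
  rw [← hi] at b1i b2i
  set h : ℝ := ξ j - c j with hh
  -- The barrier must grow away from the centre: its relevant part then lies between heights `k - 1`
  -- and `|h|` and stays in the box even when `h` is close to the boundary.
  set v : Dir := (j, decide (0 ≤ h)) with hv
  have hvh : v.sgn * h = |h| := by
    by_cases h0 : 0 ≤ h
    · simp [hv, Dir.sgn, h0, abs_of_nonneg h0]
    · simp [hv, Dir.sgn, h0, abs_of_neg (not_le.1 h0)]
  set k : ℕ := ⌊|h|⌋₊ with hk
  have hk1 : (k : ℝ) ≤ |h| := Nat.floor_le (abs_nonneg h)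
  have hk2 : |h| < k + 1 := Nat.lt_floor_add_one _
  -- the left end point
  obtain ⟨a, ha1, ha2, hat⟩ : ∃ a : ℝ, -(s / 2) ≤ a ∧ a + (t₂ - t₁) ≤ s / 2 ∧
      ∀ p, a < p → p < a + (t₂ - t₁) → ∃ t, t₁ < t ∧ t < t₂ ∧ ξ i - c i + t * u.sgn = p := by
    rw [abs_le] at b1i b2i
    unfold Dir.sgn at b1i b2i ⊢
    split_ifs at b1i b2i ⊢
    · exact ⟨ξ i - c i + t₁, by linarith, by linarith, fun p h1 h2 =>
        ⟨p - (ξ i - c i), by linarith, by linarith, by ring⟩⟩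
    · exact ⟨ξ i - c i - t₂, by linarith, by linarith, fun p h1 h2 =>
        ⟨ξ i - c i - p, by linarith, by linarith, by ring⟩⟩
  set m : ℤ := ⌊a / 6⌋ with hm
  have hm1 : 6 * (m : ℝ) ≤ a := by
    have := Int.floor_le (a / 6); linarith
  have hm2 : a < 6 * (m : ℝ) + 6 := by
    have := Int.lt_floor_add_one (a / 6); linarith
  have hn : (windowSize L : ℝ) ≤ L / 12 := Nat.floor_le (by linarith)
  -- The window lies within `[a, a + L]`: it starts at `6 (m + 2) - 5 / 2 > a` and ends at most at
  -- `a + 6 + L / 2 + 5 / 2`, where `L ≥ 18` suffices.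
  obtain ⟨q, hq⟩ := hev v m k ⟨by linarith, by linarith⟩ (hk1.trans b1j)
  have hqn : ((q : ℕ) : ℝ) + 1 ≤ windowSize L := by exact_mod_cast q.2
  have hq0 : (0 : ℝ) ≤ ((q : ℕ) : ℝ) := Nat.cast_nonneg _
  obtain ⟨⟨η', w⟩, hyω, ⟨rfl, hc1, hc2, hc3⟩, hyb⟩ := hq.exists_mem
  obtain ⟨η, rfl⟩ : ∃ η, η' = η - c := ⟨η' + c, by simp⟩
  change |(η - c) (1 - j) - 6 * _| ≤ 1 / 2 at hc1
  change _ ≤ v.sgn * (η - c) j at hc2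
  change v.sgn * (η - c) j ≤ _ at hc3
  rw [hij, Pi.sub_apply, abs_le] at hc1
  rw [Pi.sub_apply] at hc2 hc3
  push_cast at hc1
  have hyφ : ((η, v) : MPoint 2 Dir) ∈ φ.carrier := (hφω (η, v) hyb).2 hyω
  -- The length that the barrier needs to reach height `|h|`. It is at most 2, so a possible stopper
  -- is at most `1 / 2 + 2 = 5 / 2` away from the centre line of the cell.
  set d : ℝ := |h| - v.sgn * (η j - c j) with hd
  have hd0 : 0 ≤ d := by linarith
  have hd2 : d ≤ 2 := by linarith
  have hlen : ENNReal.ofReal d < f (η, v) := by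
    refine lt_length_of_shadow_empty hg hf hyφ hd0 ?_
    rintro ⟨ζ, w⟩ hz h1 h2 h3 h4
    change w.1 ≠ j at h1
    change |ζ (1 - j) - η (1 - j)| ≤ d at h2
    change v.sgn * η j ≤ v.sgn * ζ j at h3
    change v.sgn * ζ j ≤ v.sgn * η j + d at h4
    rw [hij, abs_le] at h2
    -- The height of `ζ` lies between `k - 1 ≥ -1 ≥ -s / 2` and `|h| ≤ s / 2`, so truncating the
    -- shadow to the box loses no stopper.
    have hzb : ζ - c ∈ box 2 s := by
      intro l
      rw [Pi.sub_apply]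
      by_cases hl : l = i
      · rw [hl, abs_le]
        constructor <;> linarith
      · have hl' : l = j := Fin.eq_one_sub_of_ne hl
        rw [hl']
        have hvabs : |ζ j - c j| = |v.sgn * (ζ j - c j)| := by
          rw [abs_mul]
          have : |v.sgn| = 1 := by unfold Dir.sgn; split <;> simp
          rw [this, one_mul]
        have hk0 : (0 : ℝ) ≤ k := Nat.cast_nonneg _
        rw [hvabs, abs_le, mul_sub]
        rw [mul_sub] at hc2 hc3 hd
        constructor <;> linarith
    refine hq.notMem_shadow ((hφω (ζ, w) hzb).1 hz) hzb ⟨h1, ?_, ?_, ?_⟩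
    · change |(ζ - c) (1 - j) - 6 * _| ≤ 5 / 2
      rw [hij, Pi.sub_apply, abs_le]
      push_cast
      constructor <;> linarith
    · change _ ≤ v.sgn * (ζ - c) j
      rw [Pi.sub_apply, mul_sub]
      rw [mul_sub] at hc2
      linarith
    · change v.sgn * (ζ - c) j ≤ _
      rw [Pi.sub_apply, mul_sub]
      rw [mul_sub] at hd
      linarith
  obtain ⟨t, hta, htb, hte⟩ := hat (η i - c i) (by linarith) (by linarith)
  have hne : ((ξ, u) : MPoint 2 Dir) ≠ (η, v) := by
    intro he
    exact hji (congrArg (fun z : MPoint 2 Dir => z.2.1) he).symm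
  have ht2 : 0 < t₂ := by linarith
  have hdis := hf.hardCore _ hx _ hyφ hne
  rw [Set.disjoint_left] at hdis
  -- The crossing point lies on both half-open segments: at parameter `t` on that of `x`, at
  -- parameter `d` on the barrier.
  refine hdis (a := ξ + t • u.vec)
    ⟨t, by linarith, ((ENNReal.ofReal_lt_ofReal_iff ht2).2 htb).trans_le ht₂, rfl⟩
    ⟨d, hd0, hlen, ?_⟩
  funext l
  simp only [Pi.add_apply, Pi.smul_apply, smul_eq_mul]
  by_cases hl : l = i
  · rw [hl, Dir.vec_of_ne (v := v) (i := i) hji.symm, hi, Dir.vec_axis, ← hi]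
    linarith
  · have hl' : l = j := Fin.eq_one_sub_of_ne hl
    have : v.vec j = v.sgn := Dir.vec_axis v
    rw [hl', Dir.vec_of_ne (v := u) (i := j) hji, this]
    have e : d * v.sgn = h - (η j - c j) := by
      rw [hd, ← hvh]
      have := v.sgn_mul_self
      linear_combination (h - (η j - c j)) * this
    rw [e]
    ring

/-! ### Probability of barriers -/

instance : IsProbabilityMeasure uniformDir :=
  ProbabilityTheory.isProbabilityMeasure_uniformOn Set.finite_univ Set.univ_nonempty

lemma uniformDir_singleton (v : Dir) : uniformDir {v} = 1 / 4 := by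
  rw [uniformDir, ProbabilityTheory.uniformOn_univ]
  simp

/-! ### Measurability -/

lemma Config.measurable_count {d : ℕ} {M : Type} [MeasurableSpace M] {B : Set (MPoint d M)}
    (hB : MeasurableSet B) (hb : ∃ r, B ⊆ markedBox d M r) :
    Measurable (Config.count B : Config d M → ℕ) := by
  rw [measurable_iff_comap_le]
  exact le_iSup_of_le B (le_iSup_of_le hB (le_iSup_of_le hb le_rfl))

lemma measurableSet_markedBox (r : ℝ) : MeasurableSet (markedBox 2 Dir r) := by
  unfold markedBox box
  simp only [Set.mem_ofPred_eq]
  measurability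

lemma measurableSet_barrierCore (v : Dir) (m : ℤ) (k : ℕ) :
    MeasurableSet (barrierCore v m k) := by
  unfold barrierCore
  measurability

lemma measurableSet_barrierShadow (v : Dir) (m : ℤ) (k : ℕ) :
    MeasurableSet (barrierShadow v m k) := by
  have h : MeasurableSet {x : MPoint 2 Dir | |x.1 (1 - v.1) - 6 * m| ≤ 5 / 2 ∧
      k - 1 ≤ v.sgn * x.1 v.1 ∧ v.sgn * x.1 v.1 ≤ k + 1} := by
    measurability
  exact (measurable_snd (MeasurableSet.of_discrete (s := {w : Dir | w.1 ≠ v.1}))).inter h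

lemma measurableSet_hasBarrier (s : ℝ) (v : Dir) (m : ℤ) (k : ℕ) :
    MeasurableSet {φ | HasBarrier s v m k φ} := by
  refine MeasurableSet.inter ?_ ?_
  · exact Config.measurable_count ((measurableSet_barrierCore v m k).inter
      (measurableSet_markedBox s)) ⟨s, Set.inter_subset_right⟩
      (MeasurableSet.of_discrete (s := {n : ℕ | n ≠ 0}))
  · exact Config.measurable_count ((measurableSet_barrierShadow v m k).inter
      (measurableSet_markedBox s)) ⟨s, Set.inter_subset_right⟩
      (MeasurableSet.of_discrete (s := {n : ℕ | n = 0}))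

lemma measurableSet_barrierEvent (s L : ℝ) : MeasurableSet (barrierEvent s L) := by
  simp only [barrierEvent, Set.ofPred_and, Set.ofPred_forall, Set.ofPred_exists]
  refine (MeasurableSet.const _).inter ((MeasurableSet.const _).inter ?_)
  refine MeasurableSet.iInter fun v => MeasurableSet.iInter fun m => MeasurableSet.iInter fun k =>
    MeasurableSet.iInter fun _ => MeasurableSet.iInter fun _ => MeasurableSet.iUnion fun q => ?_
  exact measurableSet_hasBarrier _ _ _ _

/-- If pairs of events are built from mutually independent variables, the probability that none of
the pairs of events occurs factorizes. -/
lemma measure_iInter_compl_inter_le {Ω ι : Type*} [MeasurableSpace Ω] [Fintype ι]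
    {P : Measure Ω} [IsProbabilityMeasure P] {g : ι × Bool → Ω → ℕ} (hg : ∀ a, Measurable (g a))
    (hind : ProbabilityTheory.iIndepFun g P) (S T : Set ℕ) {p : ℝ≥0∞}
    (hp : ∀ q, p ≤ P (g (q, true) ⁻¹' S) * P (g (q, false) ⁻¹' T)) :
    P (⋂ q, (g (q, true) ⁻¹' S ∩ g (q, false) ⁻¹' T)ᶜ) ≤ (1 - p) ^ Fintype.card ι := by
  classical
  set G : ι → Set Ω := fun q => g (q, true) ⁻¹' S ∩ g (q, false) ⁻¹' T with hG
  have hGm : ∀ q, MeasurableSet (G q) := fun q =>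
    (hg _ .of_discrete).inter (hg _ .of_discrete)
  -- Independence over `F × Bool` factorizes the intersection of the pairs. This gives independence
  -- of the events `G q`, and hence of their complements.
  have hprod : ∀ F : Finset ι, P (⋂ q ∈ F, G q) =
      ∏ q ∈ F, P (g (q, true) ⁻¹' S) * P (g (q, false) ⁻¹' T) := by
    intro F
    have := hind.measure_inter_preimage_eq_mul (F ×ˢ Finset.univ)
      (sets := fun a => if a.2 then S else T) (fun _ _ => .of_discrete)
    rw [Finset.prod_product] at this
    simp only [Fintype.prod_bool, if_true, Bool.false_eq_true, if_false] at this
    rw [← this]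
    congr 1
    ext ω
    simp only [hG, Set.mem_iInter, Set.mem_inter_iff, Set.mem_preimage, Finset.mem_product,
      Finset.mem_univ, and_true, Prod.forall, Bool.forall_bool, if_true, Bool.false_eq_true,
      if_false]
    exact forall_congr' fun q => by tauto
  have hsingle : ∀ q, P (G q) = P (g (q, true) ⁻¹' S) * P (g (q, false) ⁻¹' T) := by
    intro q
    simpa using hprod {q}
  have hGind : ProbabilityTheory.iIndepSet G P := by
    rw [ProbabilityTheory.iIndepSet_iff_meas_biInter hGm]
    intro F
    rw [hprod F]
    exact Finset.prod_congr rfl fun q _ => (hsingle q).symm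
  rw [ProbabilityTheory.iIndepSet_iff_iIndep] at hGind
  rw [hGind.meas_iInter fun q =>
    (MeasurableSpace.measurableSet_generateFrom (Set.mem_singleton _)).compl]
  calc ∏ q, P (G q)ᶜ ≤ ∏ _q : ι, (1 - p) := by
        refine Finset.prod_le_prod' fun q _ => ?_
        rw [prob_compl_eq_one_sub (hGm q), hsingle q]
        exact tsub_le_tsub_left (hp q) 1
    _ = _ := by simp

/-! ### Intensity of cores and shadows -/

/-- A rectangle with given sides in the coordinates `1 - j` and `j`. -/
lemma volume_rectangle (j : Fin 2) (S T : Set ℝ) :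
    volume {ξ : Fin 2 → ℝ | ξ (1 - j) ∈ S ∧ ξ j ∈ T} = volume S * volume T := by
  have : {ξ : Fin 2 → ℝ | ξ (1 - j) ∈ S ∧ ξ j ∈ T} =
      Set.univ.pi fun l => if l = j then T else S := by
    ext ξ
    fin_cases j <;> simp [Fin.forall_fin_two, and_comm]
  rw [this, volume_pi_pi, Fin.prod_univ_two]
  fin_cases j <;> simp [mul_comm]

lemma volume_sgn_mul_Icc (v : Dir) (a b : ℝ) :
    volume {t : ℝ | a ≤ v.sgn * t ∧ v.sgn * t ≤ b} = ENNReal.ofReal (b - a) := by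
  unfold Dir.sgn
  split_ifs
  · simp only [one_mul]
    exact Real.volume_Icc
  · have : {t : ℝ | a ≤ -1 * t ∧ -1 * t ≤ b} = Set.Icc (-b) (-a) := by
      ext t
      simp only [Set.mem_ofPred_eq, Set.mem_Icc]
      constructor <;> rintro ⟨h1, h2⟩ <;> constructor <;> linarith
    rw [this, Real.volume_Icc]
    congr 1; ring

lemma volume_abs_sub_le (a r : ℝ) : volume {t : ℝ | |t - a| ≤ r} = ENNReal.ofReal (2 * r) := by
  have : {t : ℝ | |t - a| ≤ r} = Metric.closedBall a r := by
    ext t; simp [Real.dist_eq]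
  rw [this, Real.volume_closedBall]

/-- The intensity measure of the marked Poisson process. -/
abbrev intensity (lam : ℝ) : Measure (MPoint 2 Dir) :=
  (ENNReal.ofReal lam • (volume : Measure (Fin 2 → ℝ))).prod uniformDir

lemma intensity_barrierCore (lam : ℝ) (v : Dir) (m : ℤ) (k : ℕ) :
    intensity lam (barrierCore v m k) = ENNReal.ofReal lam * (1 / 4) := by
  have : barrierCore v m k = {ξ : Fin 2 → ℝ | ξ (1 - v.1) ∈ {t : ℝ | |t - 6 * m| ≤ 1 / 2} ∧
      ξ v.1 ∈ {t : ℝ | (k : ℝ) - 1 ≤ v.sgn * t ∧ v.sgn * t ≤ k}} ×ˢ {v} := by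
    ext x
    simp only [barrierCore, Set.mem_ofPred_eq, Set.mem_prod, Set.mem_singleton_iff]
    tauto
  rw [this, Measure.prod_prod, uniformDir_singleton, Measure.smul_apply, volume_rectangle,
    volume_abs_sub_le, volume_sgn_mul_Icc]
  norm_num

lemma intensity_barrierShadow_le (lam : ℝ) (v : Dir) (m : ℤ) (k : ℕ) :
    intensity lam (barrierShadow v m k) ≤ ENNReal.ofReal lam * 10 := by
  have : barrierShadow v m k ⊆ {ξ : Fin 2 → ℝ | ξ (1 - v.1) ∈ {t : ℝ | |t - 6 * m| ≤ 5 / 2} ∧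
      ξ v.1 ∈ {t : ℝ | (k : ℝ) - 1 ≤ v.sgn * t ∧ v.sgn * t ≤ k + 1}} ×ˢ Set.univ := by
    intro x hx
    exact ⟨hx.2, Set.mem_univ _⟩
  refine (measure_mono this).trans ?_
  rw [Measure.prod_prod, measure_univ, mul_one, Measure.smul_apply, volume_rectangle,
    volume_abs_sub_le, volume_sgn_mul_Icc, ← ENNReal.ofReal_mul (by norm_num), smul_eq_mul]
  gcongr
  rw [← ENNReal.ofReal_ofNat]
  exact ENNReal.ofReal_le_ofReal (by linarith)

/-- Truncation to the box costs the core no mass, which keeps the lower bound on its being occupied.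
For the shadow truncation only helps. -/
lemma barrierCore_subset_markedBox {s L : ℝ} (hs : 2 ≤ s) {m : ℤ}
    (hm : WindowInBox s L m) {k : ℕ} (hk : (k : ℝ) ≤ s / 2) (v : Dir) (q : Fin (windowSize L)) :
    barrierCore v (m + 2 + (q : ℕ)) k ⊆ markedBox 2 Dir s := by
  rintro x ⟨-, h1, h2, h3⟩ l
  obtain ⟨hm1, hm2⟩ := hm
  have hqn : ((q : ℕ) : ℝ) + 1 ≤ windowSize L := by exact_mod_cast q.2
  have hq0 : (0 : ℝ) ≤ ((q : ℕ) : ℝ) := Nat.cast_nonneg _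
  have hk0 : (0 : ℝ) ≤ k := Nat.cast_nonneg _
  rw [abs_le] at h1
  push_cast at h1
  by_cases hl : l = v.1
  · rw [hl, abs_le]
    unfold Dir.sgn at h2 h3
    split_ifs at h2 h3 <;> constructor <;> linarith
  · rw [Fin.eq_one_sub_of_ne hl, abs_le]
    constructor <;> linarith

/-- The lower bound for the probability of a barrier. -/
def barrierProb (lam : ℝ) : ℝ := (1 - Real.exp (-(lam / 8))) * Real.exp (-(10 * lam))

lemma barrierProb_pos {lam : ℝ} (h : 0 < lam) : 0 < barrierProb lam := by
  have : Real.exp (-(lam / 8)) < 1 := Real.exp_lt_one_iff.2 (by linarith)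
  exact mul_pos (by linarith) (Real.exp_pos _)

lemma barrierProb_lt_one {lam : ℝ} (h : 0 < lam) : barrierProb lam < 1 := by
  have h1 : Real.exp (-(10 * lam)) < 1 := Real.exp_lt_one_iff.2 (by linarith)
  have h2 := Real.exp_pos (-(lam / 8))
  have h3 := Real.exp_pos (-(10 * lam))
  unfold barrierProb
  nlinarith

section Poisson

variable {Ω : Type*} [MeasurableSpace Ω] {P : Measure Ω}
  {X : Ω → Config 2 Dir} {mu : ℝ}

lemma IsMarkedPoisson.measurable_count (hX : IsMarkedPoisson P X mu uniformDir)
    {B : Set (MPoint 2 Dir)} (hB : MeasurableSet B) (hb : ∃ r, B ⊆ markedBox 2 Dir r) :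
    Measurable fun ω => (X ω).count B :=
  (Config.measurable_count hB hb).comp hX.measurable

lemma IsMarkedPoisson.measure_count_eq_zero (hX : IsMarkedPoisson P X mu uniformDir)
    {B : Set (MPoint 2 Dir)} (hB : MeasurableSet B) (hb : ∃ r, B ⊆ markedBox 2 Dir r) :
    P ((fun ω => (X ω).count B) ⁻¹' {0}) =
      ENNReal.ofReal (Real.exp (-(intensity mu B).toReal)) := by
  have h := congrArg (fun Q : Measure ℕ => Q {0}) (hX.poisson B hB hb)
  simp only [Measure.map_apply (hX.measurable_count hB hb) (MeasurableSet.singleton 0),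
    ProbabilityTheory.poissonMeasure_singleton] at h
  rw [h]
  simp [ENNReal.coe_toNNReal_eq_toReal]

/-- The core has area 1 and one of four marks, hence mass `mu / 4 ≥ lam / 8`. The shadow lies in a
`5 × 2` rectangle, hence has mass at most `10 * lam`. The bound is uniform in `mu ∈ [lam / 2, lam]`,
so the thinning does not matter. -/
lemma IsMarkedPoisson.barrierProb_le [IsProbabilityMeasure P]
    (hX : IsMarkedPoisson P X mu uniformDir) {lam : ℝ}
    (hlam : 0 < lam) (h1 : lam / 2 ≤ mu) (h2 : mu ≤ lam) {s : ℝ} {v : Dir} {m : ℤ} {k : ℕ}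
    (hc : barrierCore v m k ⊆ markedBox 2 Dir s) :
    ENNReal.ofReal (barrierProb lam) ≤
      P ((fun ω => (X ω).count (barrierCore v m k ∩ markedBox 2 Dir s)) ⁻¹' {0}ᶜ) *
      P ((fun ω => (X ω).count (barrierShadow v m k ∩ markedBox 2 Dir s)) ⁻¹' {0}) := by
  have mC := (measurableSet_barrierCore v m k).inter (measurableSet_markedBox s)
  have mS := (measurableSet_barrierShadow v m k).inter (measurableSet_markedBox s)
  have bC : ∃ r, barrierCore v m k ∩ markedBox 2 Dir s ⊆ markedBox 2 Dir r :=
    ⟨s, Set.inter_subset_right⟩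
  have bS : ∃ r, barrierShadow v m k ∩ markedBox 2 Dir s ⊆ markedBox 2 Dir r :=
    ⟨s, Set.inter_subset_right⟩
  have hmu : 0 ≤ mu := by linarith
  have e1 : Real.exp (-(lam / 8)) ≤ 1 := Real.exp_le_one_iff.2 (by linarith)
  rw [barrierProb, ENNReal.ofReal_mul (by linarith), Set.preimage_compl,
    prob_compl_eq_one_sub (hX.measurable_count mC bC (MeasurableSet.singleton 0)),
    hX.measure_count_eq_zero mC bC, hX.measure_count_eq_zero mS bS]
  refine mul_le_mul' ?_ ?_
  · rw [ENNReal.ofReal_sub _ (Real.exp_pos _).le, ENNReal.ofReal_one,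
      Set.inter_eq_left.2 hc, intensity_barrierCore]
    refine tsub_le_tsub_left (ENNReal.ofReal_le_ofReal (Real.exp_le_exp.2 ?_)) _
    rw [ENNReal.toReal_mul, ENNReal.toReal_ofReal hmu]
    norm_num
    linarith
  · refine ENNReal.ofReal_le_ofReal (Real.exp_le_exp.2 ?_)
    rw [neg_le_neg_iff]
    refine ENNReal.toReal_le_of_le_ofReal (by linarith) ?_
    refine (measure_mono Set.inter_subset_left).trans
      ((intensity_barrierShadow_le mu v m k).trans ?_)
    rw [mul_comm 10, ENNReal.ofReal_mul hlam.le, ENNReal.ofReal_ofNat]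
    gcongr

lemma disjoint_barrierCore {v : Dir} {m m' : ℤ} (h : m ≠ m') (k : ℕ) :
    Disjoint (barrierCore v m k) (barrierCore v m' k) := by
  refine Set.disjoint_left.2 fun x h1 h2 => ?_
  have a1 := abs_le.1 h1.2.1
  have a2 := abs_le.1 h2.2.1
  rcases lt_or_gt_of_ne h with h | h
  · have : (m : ℝ) + 1 ≤ m' := by exact_mod_cast h
    linarith
  · have : (m' : ℝ) + 1 ≤ m := by exact_mod_cast h
    linarith

/-- Shadows have width 5 and their centres are at least 6 apart. -/
lemma disjoint_barrierShadow {v : Dir} {m m' : ℤ} (h : m ≠ m') (k : ℕ) :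
    Disjoint (barrierShadow v m k) (barrierShadow v m' k) := by
  refine Set.disjoint_left.2 fun x h1 h2 => ?_
  have a1 := abs_le.1 h1.2.1
  have a2 := abs_le.1 h2.2.1
  rcases lt_or_gt_of_ne h with h | h
  · have : (m : ℝ) + 1 ≤ m' := by exact_mod_cast h
    linarith
  · have : (m' : ℝ) + 1 ≤ m := by exact_mod_cast h
    linarith

lemma disjoint_barrierCore_barrierShadow (v : Dir) (m m' : ℤ) (k : ℕ) :
    Disjoint (barrierCore v m k) (barrierShadow v m' k) :=
  Set.disjoint_left.2 fun _ h1 h2 => h2.1 (by rw [h1.1])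

lemma IsMarkedPoisson.iIndepFun_count {ι : Type*} [Fintype ι]
    (hX : IsMarkedPoisson P X mu uniformDir) {B : ι → Set (MPoint 2 Dir)}
    (hB : ∀ a, MeasurableSet (B a)) (hb : ∀ a, ∃ r, B a ⊆ markedBox 2 Dir r)
    (hd : Pairwise fun a b => Disjoint (B a) (B b)) :
    ProbabilityTheory.iIndepFun (fun a ω => (X ω).count (B a)) P := by
  have e := Fintype.equivFin ι
  have h := hX.indep _ (B ∘ e.symm) (fun _ => hB _) (fun _ => hb _)
    fun a b hab => hd (e.symm.injective.ne hab)
  simpa [Function.comp_def] using h.precomp e.injective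

/-- A window without barriers is exponentially unlikely. -/
lemma IsMarkedPoisson.measure_no_barrier_le [IsProbabilityMeasure P]
    (hX : IsMarkedPoisson P X mu uniformDir) {lam : ℝ}
    (hlam : 0 < lam) (h1 : lam / 2 ≤ mu) (h2 : mu ≤ lam) {s L : ℝ} (hs : 2 ≤ s) {m : ℤ}
    (hm : WindowInBox s L m) {k : ℕ} (hk : (k : ℝ) ≤ s / 2) (v : Dir) :
    P {ω | ∀ q : Fin (windowSize L), ¬ HasBarrier s v (m + 2 + (q : ℕ)) k (X ω)} ≤
      ENNReal.ofReal ((1 - barrierProb lam) ^ windowSize L) := by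
  set B : Fin (windowSize L) × Bool → Set (MPoint 2 Dir) := fun a =>
    (if a.2 then barrierCore v (m + 2 + (a.1 : ℕ)) k else barrierShadow v (m + 2 + (a.1 : ℕ)) k) ∩
      markedBox 2 Dir s with hBdef
  have hB : ∀ a, MeasurableSet (B a) := by
    rintro ⟨q, b⟩
    refine MeasurableSet.inter ?_ (measurableSet_markedBox s)
    cases b
    · exact measurableSet_barrierShadow _ _ _
    · exact measurableSet_barrierCore _ _ _
  have hb : ∀ a, ∃ r, B a ⊆ markedBox 2 Dir r := fun a => ⟨s, Set.inter_subset_right⟩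
  have hd : Pairwise fun a b => Disjoint (B a) (B b) := by
    rintro ⟨q, b⟩ ⟨q', b'⟩ hne
    refine Disjoint.mono Set.inter_subset_left Set.inter_subset_left ?_
    have hq : b = b' → (m + 2 + ((q : ℕ) : ℤ)) ≠ m + 2 + ((q' : ℕ) : ℤ) := by
      rintro rfl he
      apply hne
      have : (q : ℕ) = q' := by omega
      rw [Fin.ext this]
    cases b <;> cases b'
    · exact disjoint_barrierShadow (hq rfl) k
    · exact (disjoint_barrierCore_barrierShadow _ _ _ _).symm
    · exact disjoint_barrierCore_barrierShadow _ _ _ _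
    · exact disjoint_barrierCore (hq rfl) k
  have key := measure_iInter_compl_inter_le (g := fun a ω => (X ω).count (B a))
    (fun a => hX.measurable_count (hB a) (hb a)) (hX.iIndepFun_count hB hb hd) {0}ᶜ {0}
    (p := ENNReal.ofReal (barrierProb lam))
    fun q => hX.barrierProb_le hlam h1 h2 (barrierCore_subset_markedBox hs hm hk v q)
  rw [Fintype.card_fin, ← ENNReal.ofReal_one, ← ENNReal.ofReal_sub _ (barrierProb_pos hlam).le,
    ← ENNReal.ofReal_pow (by linarith [barrierProb_lt_one hlam])] at key
  refine le_trans (measure_mono ?_) key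
  intro ω hω
  simp only [Set.mem_iInter]
  exact fun q hq => hω q hq

/-- Union bound over all windows. -/
lemma IsMarkedPoisson.measure_compl_barrierEvent_le [IsProbabilityMeasure P]
    (hX : IsMarkedPoisson P X mu uniformDir)
    {lam : ℝ} (hlam : 0 < lam) (h1 : lam / 2 ≤ mu) (h2 : mu ≤ lam) {s L : ℝ} (hs : 2 ≤ s)
    (hL : 18 ≤ L) :
    P {ω | X ω ∉ barrierEvent s L} ≤
      ENNReal.ofReal (48 * s ^ 2 * (1 - barrierProb lam) ^ windowSize L) := by
  classical
  -- Only finitely many windows are relevant: fitting into the box forces `|m| ≤ ⌊s⌋₊` and `k ≤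
  -- ⌊s⌋₊`.
  set W : Finset (Dir × ℤ × ℕ) := (Finset.univ ×ˢ Finset.Icc (-(⌊s⌋₊ : ℤ)) ⌊s⌋₊ ×ˢ
    Finset.range (⌊s⌋₊ + 1)).filter fun w => WindowInBox s L w.2.1 ∧ (w.2.2 : ℝ) ≤ s / 2 with hW
  have hsub : {ω | X ω ∉ barrierEvent s L} ⊆ ⋃ w ∈ W,
      {ω | ∀ q : Fin (windowSize L), ¬ HasBarrier s w.1 (w.2.1 + 2 + (q : ℕ)) w.2.2 (X ω)} := by
    intro ω hω
    simp only [barrierEvent, Set.mem_ofPred_eq, hs, hL, true_and] at hω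
    push Not at hω
    obtain ⟨v, m, k, hm, hk, hq⟩ := hω
    simp only [Set.mem_iUnion]
    refine ⟨(v, m, k), ?_, hq⟩
    have hf := Nat.lt_floor_add_one s
    have hw0 : (0 : ℝ) ≤ windowSize L := Nat.cast_nonneg _
    have hkk : k < ⌊s⌋₊ + 1 := by
      have : (k : ℝ) < ⌊s⌋₊ + 1 := by linarith
      exact_mod_cast this
    have hm1 : -(⌊s⌋₊ : ℤ) - 1 < m := by
      have : -((⌊s⌋₊ : ℕ) : ℝ) - 1 < m := by linarith [hm.1]
      exact_mod_cast this
    have hm2 : m < (⌊s⌋₊ : ℤ) + 1 := by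
      have : (m : ℝ) < ((⌊s⌋₊ : ℕ) : ℝ) + 1 := by linarith [hm.2]
      exact_mod_cast this
    simp only [hW, Finset.mem_filter, Finset.mem_product, Finset.mem_univ, true_and,
      Finset.mem_Icc, Finset.mem_range]
    exact ⟨⟨⟨by omega, by omega⟩, hkk⟩, hm, hk⟩
  have hcard : (W.card : ℝ) ≤ 48 * s ^ 2 := by
    have h : W.card ≤ 4 * ((2 * ⌊s⌋₊ + 1) * (⌊s⌋₊ + 1)) := by
      refine (Finset.card_filter_le _ _).trans (le_of_eq ?_)
      rw [Finset.card_product, Finset.card_product, Int.card_Icc, Finset.card_range,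
        Finset.card_univ]
      have : ((⌊s⌋₊ : ℤ) + 1 - -(⌊s⌋₊ : ℤ)).toNat = 2 * ⌊s⌋₊ + 1 := by omega
      rw [this]
      rfl
    have h' : (W.card : ℝ) ≤ 4 * ((2 * ⌊s⌋₊ + 1) * (⌊s⌋₊ + 1)) := by exact_mod_cast h
    have hf : (⌊s⌋₊ : ℝ) ≤ s := Nat.floor_le (by linarith)
    have hf0 : (0 : ℝ) ≤ ⌊s⌋₊ := Nat.cast_nonneg _
    nlinarith
  have hp0 : 0 ≤ (1 - barrierProb lam) ^ windowSize L :=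
    pow_nonneg (by linarith [barrierProb_lt_one hlam]) _
  calc P {ω | X ω ∉ barrierEvent s L}
      ≤ ∑ w ∈ W, P {ω | ∀ q : Fin (windowSize L),
          ¬ HasBarrier s w.1 (w.2.1 + 2 + (q : ℕ)) w.2.2 (X ω)} :=
        (measure_mono hsub).trans (measure_biUnion_finset_le _ _)
    _ ≤ ∑ _w ∈ W, ENNReal.ofReal ((1 - barrierProb lam) ^ windowSize L) := by
        refine Finset.sum_le_sum fun w hw => ?_
        obtain ⟨-, hm, hk⟩ := Finset.mem_filter.1 hw
        exact hX.measure_no_barrier_le hlam h1 h2 hs hm hk w.1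
    _ = ENNReal.ofReal (W.card * (1 - barrierProb lam) ^ windowSize L) := by
        rw [Finset.sum_const, nsmul_eq_mul, ENNReal.ofReal_mul (Nat.cast_nonneg _),
          ENNReal.ofReal_natCast]
    _ ≤ _ := ENNReal.ofReal_le_ofReal (mul_le_mul_of_nonneg_right hcard hp0)

end Poisson

/-- Stretched exponential decay beats the number of windows. -/
lemma tendsto_windows_mul_pow {p β : ℝ} (hp0 : 0 < p) (hp1 : p < 1) (hβ : 0 < β) :
    Tendsto (fun s : ℝ => 48 * s ^ 2 * (1 - p) ^ windowSize (s ^ β)) atTop (𝓝 0) := by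
  set c : ℝ := -Real.log (1 - p) / 12 with hc
  have hcpos : 0 < c := by
    have := Real.log_neg (by linarith : 0 < 1 - p) (by linarith)
    rw [hc]; linarith
  -- Substitute `y = s ^ β` in `y ^ (2 / β) * exp (-c * y) → 0`. The factor `exp (12 * c) = (1 -
  -- p)⁻¹` pays for the floor in `windowSize`.
  have lim := ((tendsto_rpow_mul_exp_neg_mul_atTop_nhds_zero (2 / β) c hcpos).comp
    (tendsto_rpow_atTop hβ)).const_mul (48 * Real.exp (12 * c))
  rw [mul_zero] at lim
  refine squeeze_zero' (Eventually.of_forall fun s => ?_) ?_ lim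
  · have : 0 ≤ 1 - p := by linarith
    positivity
  filter_upwards [eventually_ge_atTop (0 : ℝ)] with s hs
  have e1 : (s ^ β) ^ (2 / β) = s ^ 2 := by
    rw [← Real.rpow_mul hs, mul_div_cancel₀ _ hβ.ne', Real.rpow_ofNat]
  have e2 : (1 - p) ^ windowSize (s ^ β) ≤ Real.exp (12 * c) * Real.exp (-c * s ^ β) := by
    have hw : s ^ β / 12 < windowSize (s ^ β) + 1 := Nat.lt_floor_add_one _
    rw [← Real.exp_add, ← Real.exp_log (by linarith : 0 < 1 - p), ← Real.exp_nat_mul,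
      Real.exp_le_exp]
    have : Real.log (1 - p) = -(12 * c) := by rw [hc]; ring
    rw [this]
    nlinarith
  simp only [Function.comp, e1]
  calc 48 * s ^ 2 * (1 - p) ^ windowSize (s ^ β)
      ≤ 48 * s ^ 2 * (Real.exp (12 * c) * Real.exp (-c * s ^ β)) := by gcongr
    _ = _ := by ring

/-- The barrier events have high probability. -/
theorem tendsto_measure_barrierEvent {lam β : ℝ} (hlam : 0 < lam) (hβ : 0 < β) {Ω : Type*}
    [MeasurableSpace Ω] (P : Measure Ω) [IsProbabilityMeasure P] (X : ℝ → Ω → Config 2 Dir)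
    (hX : ∀ s > 1, IsMarkedPoisson P (X s) (lam * (1 - (s ^ 3)⁻¹)) uniformDir) :
    Tendsto (fun s => P {ω | X s ω ∈ barrierEvent s (s ^ β)}) atTop (𝓝 1) := by
  have lim := ENNReal.tendsto_ofReal
    (tendsto_windows_mul_pow (barrierProb_pos hlam) (barrierProb_lt_one hlam) hβ)
  rw [ENNReal.ofReal_zero] at lim
  have lim' := ENNReal.Tendsto.sub (tendsto_const_nhds (x := (1 : ℝ≥0∞))) lim
    (Or.inl ENNReal.one_ne_top)
  rw [tsub_zero] at lim'
  refine tendsto_of_tendsto_of_tendsto_of_le_of_le' lim' tendsto_const_nhds ?_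
    (Eventually.of_forall fun s => prob_le_one)
  -- From `s = 2` on the thinned intensity is at least `lam / 2`.
  filter_upwards [eventually_ge_atTop (2 : ℝ),
    (tendsto_rpow_atTop hβ).eventually_ge_atTop 18] with s hs hL
  have hinv : (s ^ 3)⁻¹ ≤ 1 / 2 := by
    rw [one_div]
    refine inv_anti₀ (by norm_num) ?_
    calc (2 : ℝ) ≤ 2 ^ 3 := by norm_num
      _ ≤ s ^ 3 := by gcongr
  have hinv0 : 0 ≤ (s ^ 3)⁻¹ := by positivity
  have hb := (hX s (by linarith)).measure_compl_barrierEvent_le hlam (by nlinarith)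
    (by nlinarith) hs hL
  have hmeas : MeasurableSet {ω | X s ω ∈ barrierEvent s (s ^ β)} :=
    (hX s (by linarith)).measurable (measurableSet_barrierEvent _ _)
  have hcompl : {ω | X s ω ∉ barrierEvent s (s ^ β)} =
      {ω | X s ω ∈ barrierEvent s (s ^ β)}ᶜ := rfl
  rw [hcompl, prob_compl_eq_one_sub hmeas] at hb
  rw [tsub_le_iff_right] at hb ⊢
  rwa [add_comm] at hb

/-! ### Lengths inside a box -/

/-- The opposite direction. -/
def Dir.opp (v : Dir) : Dir := (v.1, !v.2)

lemma Dir.vec_opp (v : Dir) : v.opp.vec = -v.vec := by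
  obtain ⟨i, b⟩ := v
  cases b <;> simp [Dir.opp, Dir.vec]

lemma Dir.isometry_line (ξ : Fin 2 → ℝ) (v : Dir) : Isometry fun t : ℝ => ξ + t • v.vec := by
  refine Isometry.of_dist_eq fun a b => ?_
  rw [dist_add_left, dist_eq_norm, ← sub_smul, Dir.norm_smul_vec, Real.dist_eq]

/-- The parametrization of an axis-parallel line is an isometry, so the measure equals the Lebesgue
measure of the parameter set, which is at most its diameter. -/
lemma hausdorffMeasure_segment_inter_le {ξ : Fin 2 → ℝ} {v : Dir} {r L : ℝ} (hr : 0 ≤ r)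
    {S : Set (Fin 2 → ℝ)}
    (h : ∀ t₁ t₂ : ℝ, 0 ≤ t₁ → t₂ ≤ r → ξ + t₁ • v.vec ∈ S → ξ + t₂ • v.vec ∈ S → t₂ - t₁ ≤ L) :
    μH[1] (segment ℝ ξ (ξ + r • v.vec) ∩ S) ≤ ENNReal.ofReal L := by
  set T : Set ℝ := {t | (0 ≤ t ∧ t ≤ r) ∧ ξ + t • v.vec ∈ S}
  have hsub : segment ℝ ξ (ξ + r • v.vec) ∩ S ⊆ (fun t : ℝ => ξ + t • v.vec) '' T := by
    rintro p ⟨hp, hS⟩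
    rw [segment_eq_image'] at hp
    obtain ⟨θ, ⟨h0, h1⟩, rfl⟩ := hp
    have e : ξ + θ • (ξ + r • v.vec - ξ) = ξ + (θ * r) • v.vec := by
      rw [add_sub_cancel_left, smul_smul]
    simp only [e] at hS ⊢
    exact ⟨θ * r, ⟨⟨by positivity, by nlinarith⟩, hS⟩, rfl⟩
  refine (measure_mono hsub).trans ?_
  rw [(Dir.isometry_line ξ v).hausdorffMeasure_image (Or.inl zero_le_one), hausdorffMeasure_real]
  refine (Real.volume_le_diam T).trans (Metric.ediam_le fun a ha b hb => ?_)
  rw [edist_dist, Real.dist_eq]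
  refine ENNReal.ofReal_le_ofReal (abs_sub_le_iff.2 ⟨?_, ?_⟩)
  · exact h b a hb.1.1 ha.1.2 hb.2 ha.2
  · exact h a b ha.1.1 hb.1.2 ha.2 hb.2

lemma ofReal_le_lilyLength {φ : Config 2 Dir} (hφ : φ ∈ lilyConfigs) {x : MPoint 2 Dir}
    (hx : x ∈ φ.carrier) {t : ℝ} (ht : t ≤ (lilyLength φ x).toReal) :
    ENNReal.ofReal t ≤ lilyLength φ x :=
  (ENNReal.ofReal_le_iff_le_toReal (hφ.2.2.2.2 x hx).ne).2 ht

/-- Inside the box the union has the same points as `φ`, which is all that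
`length_le_of_barrierEvent` uses. -/
theorem hausdorffMeasure_lilySegment_le {s L : ℝ} {φ ψ : Config 2 Dir}
    (hφ : φ ∈ barrierEvent s L) (hψ : ψ.carrier ⊆ (markedBox 2 Dir s)ᶜ)
    (hN : φ.union ψ ∈ lilyConfigs) {x : MPoint 2 Dir} (hx : x ∈ (φ.union ψ).carrier) :
    μH[1] (lilySegment (φ.union ψ) x ∩ box 2 s) ≤ ENNReal.ofReal L := by
  rw [lilySegment, geomDesc_eq hN hx]
  refine hausdorffMeasure_segment_inter_le ENNReal.toReal_nonneg fun t₁ t₂ h0 h1 hb₁ hb₂ => ?_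
  refine length_le_of_barrierEvent hN.2.2.1 (isLilypond_lilyLength hN) hφ 0 ?_ hx h0
    (ofReal_le_lilyLength hN hx h1) (by simpa using hb₁) (by simpa using hb₂)
  intro z hz
  rw [sub_zero] at hz
  simp only [sub_zero, Prod.mk.eta]
  exact ⟨fun h => h.resolve_right fun h' => hψ h' hz, fun h => Or.inl h⟩

/-! ### Shielding -/

/-- Separates the transversal coordinate, constant along the path, from the longitudinal one, which
grows at unit speed. -/
lemma add_smul_mem_box_iff {r : Fin 2 → ℝ} {w : Dir} {t s : ℝ} :
    r + t • w.vec ∈ box 2 s ↔ |r (1 - w.1)| ≤ s / 2 ∧ |w.sgn * r w.1 + t| ≤ s / 2 := by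
  have e1 : (r + t • w.vec) (1 - w.1) = r (1 - w.1) := by
    simp [Dir.vec_of_ne (Fin.one_sub_ne w.1)]
  have e2 : |(r + t • w.vec) w.1| = |w.sgn * r w.1 + t| := by
    simp only [Pi.add_apply, Pi.smul_apply, smul_eq_mul, Dir.vec_axis]
    unfold Dir.sgn
    split_ifs
    · simp
    · rw [← abs_neg]; congr 1; ring
  constructor
  · intro h
    exact ⟨e1 ▸ h (1 - w.1), e2 ▸ h w.1⟩
  · rintro ⟨h1, h2⟩ l
    by_cases hl : l = w.1
    · rw [hl, e2]; exact h2
    · rw [Fin.eq_one_sub_of_ne hl, e1]; exact h1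

/-- The neighbour of a lattice point in a given direction. -/
def latticeStep (z : Fin 2 → ℤ) (w : Dir) : Fin 2 → ℤ :=
  z + Pi.single w.1 (if w.2 then 1 else -1)

lemma latticePoint_latticeStep (s : ℝ) (z : Fin 2 → ℤ) (w : Dir) :
    latticePoint s (latticeStep z w) = latticePoint s z + s • w.vec := by
  funext l
  simp only [latticePoint, latticeStep, Pi.add_apply, Pi.smul_apply, smul_eq_mul, Dir.vec_apply,
    Pi.single_apply]
  split_ifs <;> push_cast <;> ring

lemma latticeGraph_adj_latticeStep (z : Fin 2 → ℤ) (w : Dir) :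
    (latticeGraph 2).Adj z (latticeStep z w) := by
  refine ⟨fun h => ?_, fun i => ?_⟩
  · have := congrFun h w.1
    simp only [latticeStep, Pi.add_apply, Pi.single_eq_same] at this
    split_ifs at this <;> omega
  · simp only [latticeStep, Pi.add_apply, Pi.single_apply]
    split_ifs <;> simp

lemma subset_hull {d : ℕ} {B B' : Set (Fin d → ℤ)} (h : Disjoint B B') : B ⊆ hull B B' := by
  intro z hz
  let b : (B'ᶜ : Set (Fin d → ℤ)) := ⟨z, Set.disjoint_left.1 h hz⟩
  exact ⟨((latticeGraph d).induce B'ᶜ).connectedComponentMk b, b, rfl, b, rfl, hz, rfl⟩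

lemma mem_hull_of_adj {d : ℕ} {B B' : Set (Fin d → ℤ)} {z z' : Fin d → ℤ} (hz : z ∈ hull B B')
    (hz' : z' ∉ B') (hadj : (latticeGraph d).Adj z z') : z' ∈ hull B B' := by
  obtain ⟨c, b, hb, a, ha, hbB, rfl⟩ := hz
  refine ⟨c, b, hb, ⟨z', hz'⟩, ?_, hbB, rfl⟩
  exact c.mem_supp_of_adj_mem_supp ha (SimpleGraph.induce_adj.2 hadj)

/-- An axis-parallel path which crosses no block of `B'` cannot leave the hull of `B`. -/
lemma mem_blocks_of_path {s L : ℝ} (hL : L < s) {B B' : Set (Fin 2 → ℤ)} (w : Dir)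
    {a : Fin 2 → ℝ} {ℓ : ℝ} (hℓ : 0 ≤ ℓ) {z : Fin 2 → ℤ} (hz : z ∈ hull B B')
    (ha : a - latticePoint s z ∈ box 2 s) (hs : 0 < s)
    (hcross : ∀ z ∈ B', ∀ t₁ t₂ : ℝ, 0 ≤ t₁ → t₂ ≤ ℓ → a + t₁ • w.vec - latticePoint s z ∈ box 2 s →
      a + t₂ • w.vec - latticePoint s z ∈ box 2 s → t₂ - t₁ ≤ L) :
    a + ℓ • w.vec ∈ blocks s (hull B B' ∪ B') := by
  -- `n` bounds the number of blocks still to be entered; for `n = 0` the path ends in the block of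
  -- `z`.
  obtain ⟨n, hn⟩ : ∃ n : ℕ, ℓ + w.sgn * (a - latticePoint s z) w.1 - s / 2 ≤ n * s := by
    obtain ⟨n, hn⟩ := exists_nat_ge ((ℓ + w.sgn * (a - latticePoint s z) w.1 - s / 2) / s)
    exact ⟨n, (div_le_iff₀ hs).1 hn⟩
  induction n generalizing a ℓ z with
  | zero =>
    refine ⟨z, Or.inl hz, ?_⟩
    have hbox := add_smul_mem_box_iff (t := 0) (w := w).1 (by simpa using ha)
    rw [add_sub_right_comm, add_smul_mem_box_iff]
    refine ⟨hbox.1, abs_le.2 ⟨?_, ?_⟩⟩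
    · linarith [(abs_le.1 hbox.2).1]
    · push_cast at hn; linarith
  | succ n ih =>
    have hbox := add_smul_mem_box_iff (t := 0) (w := w).1 (by simpa using ha)
    set r := a - latticePoint s z with hr
    have hb := abs_le.1 hbox.2
    -- The time at which the path leaves the block of `z`; during `[ℓ₁, ℓ₁ + s]` it is in the next
    -- block.
    set ℓ₁ : ℝ := s / 2 - w.sgn * r w.1 with hℓ₁
    have hℓ₁0 : 0 ≤ ℓ₁ := by linarith
    by_cases hend : ℓ ≤ ℓ₁
    · refine ⟨z, Or.inl hz, ?_⟩
      rw [add_sub_right_comm, add_smul_mem_box_iff]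
      exact ⟨hbox.1, abs_le.2 ⟨by linarith, by linarith⟩⟩
    rw [not_le] at hend
    have hrel : ∀ t : ℝ, a + t • w.vec - latticePoint s (latticeStep z w) =
        r + (t - s) • w.vec := by
      intro t
      rw [latticePoint_latticeStep, hr, sub_smul]
      abel
    have hin : ∀ t : ℝ, ℓ₁ ≤ t → t ≤ ℓ₁ + s →
        a + t • w.vec - latticePoint s (latticeStep z w) ∈ box 2 s := by
      intro t h1 h2
      rw [hrel, add_smul_mem_box_iff]
      exact ⟨hbox.1, abs_le.2 ⟨by linarith, by linarith⟩⟩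
    by_cases hB' : latticeStep z w ∈ B'
    · by_cases hend' : ℓ ≤ ℓ₁ + s
      · exact ⟨latticeStep z w, Or.inr hB', hin ℓ hend.le hend'⟩
      -- A full crossing of a block of `B'` would have length `s > L`.
      · have := hcross _ hB' ℓ₁ (ℓ₁ + s) hℓ₁0 (by linarith) (hin _ le_rfl (by linarith))
          (hin _ (by linarith) le_rfl)
        linarith
    -- Outside `B'` the neighbouring block belongs to the same component, hence to the hull; restart
    -- from its face.
    · have hsplit : ∀ t : ℝ, a + ℓ₁ • w.vec + t • w.vec = a + (ℓ₁ + t) • w.vec := fun t => by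
        rw [add_smul, add_assoc]
      have := ih (a := a + ℓ₁ • w.vec) (ℓ := ℓ - ℓ₁) (by linarith)
        (mem_hull_of_adj hz hB' (latticeGraph_adj_latticeStep z w)) (hin _ le_rfl (by linarith))
        (fun z hz t₁ t₂ h1 h2 h3 h4 => by
          rw [hsplit] at h3 h4
          have := hcross z hz (ℓ₁ + t₁) (ℓ₁ + t₂) (by linarith) (by linarith) h3 h4
          linarith)
        (by
          rw [hrel]
          simp only [Pi.add_apply, Pi.smul_apply, smul_eq_mul, Dir.vec_axis]
          have e : w.sgn * (r w.1 + (ℓ₁ - s) * w.sgn) = w.sgn * r w.1 + (ℓ₁ - s) := by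
            linear_combination (ℓ₁ - s) * w.sgn_mul_self
          rw [e]
          push_cast at hn
          linarith)
      rwa [hsplit, add_sub_cancel] at this

theorem shieldingCondition_barrierEvent {L : ℝ → ℝ} (hL : ∀ s, 2 ≤ s → L s < s) :
    ShieldingCondition lilyConfigs combDesc geomDesc fun s => barrierEvent s (L s) := by
  intro s hs1 B B' _ _ hdisj _ φ hφ hA x hx hgx
  have hs : 0 < s := by linarith
  obtain ⟨z, hzB, hza⟩ := hgx
  have hz := subset_hull hdisj hzB
  have hlily := isLilypond_lilyLength hφ
  have hev : ∀ z ∈ B', φ.shift (latticePoint s z) ∈ barrierEvent s (L s) := fun z hz =>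
    (restrict_mem_barrierEvent (by linarith) _).1 (hA z hz)
  have hlen : ∀ y ∈ φ.carrier, ∀ z ∈ B', ∀ t₁ t₂ : ℝ, 0 ≤ t₁ → t₂ ≤ (lilyLength φ y).toReal →
      y.1 + t₁ • y.2.vec - latticePoint s z ∈ box 2 s →
      y.1 + t₂ • y.2.vec - latticePoint s z ∈ box 2 s → t₂ - t₁ ≤ L s := by
    intro y hy z hz t₁ t₂ h1 h2 h3 h4
    refine length_le_of_barrierEvent hφ.2.2.1 hlily (hev z hz) (latticePoint s z) ?_ hy h1
      (ofReal_le_lilyLength hφ hy h2) h3 h4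
    intro p _
    constructor
    · exact fun hp => ⟨p, hp, rfl⟩
    · rintro ⟨p', hp', he⟩
      have he' := Prod.ext_iff.1 he
      have h1 : p'.1 = p.1 := sub_left_injective he'.1
      have h2 : p'.2 = p.2 := he'.2
      rwa [← Prod.ext h1 h2]
  -- The barrier event is empty for `s < 2`, so a block in `B'` yields `2 ≤ s`.
  have hLs : B'.Nonempty → L s < s := fun ⟨z, hz⟩ => hL s (hev z hz).1
  -- without blocks in `B'` the bound `L s` plays no role
  obtain ⟨Λ, hΛs, hΛ⟩ : ∃ Λ : ℝ, Λ < s ∧ ∀ z ∈ B', L s ≤ Λ := by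
    rcases B'.eq_empty_or_nonempty with h | h
    · exact ⟨0, hs, by simp [h]⟩
    · exact ⟨L s, hLs h, fun _ _ => le_rfl⟩
  rw [geomDesc_eq hφ hx] at hza
  obtain ⟨hy, hneighbor⟩ := combDesc_spec hφ hx
  constructor
  -- Run the segment of `x` backwards from its endpoint to `x.1`.
  · have hpt : ∀ t : ℝ, x.1 + (lilyLength φ x).toReal • x.2.vec + t • x.2.opp.vec =
        x.1 + ((lilyLength φ x).toReal - t) • x.2.vec := fun t => by
      rw [Dir.vec_opp, smul_neg, sub_smul]; abel
    have := mem_blocks_of_path hΛs x.2.opp (ℓ := (lilyLength φ x).toReal)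
      ENNReal.toReal_nonneg hz hza hs fun z hz t₁ t₂ h1 h2 h3 h4 => by
        rw [hpt] at h3 h4
        have := hlen x hx z hz _ _ (by linarith) (by linarith) h4 h3
        linarith [hΛ z hz]
    rwa [hpt, sub_self, zero_smul, add_zero] at this
  -- The endpoint of `x` lies on the segment of its stopping neighbor `y`; follow the latter forward
  -- to its own endpoint.
  · obtain ⟨⟨t, ht0, htf, hp⟩, -⟩ := hneighbor
    rw [geomDesc_eq hφ hy]
    set y := combDesc φ x
    have htf' : t ≤ (lilyLength φ y).toReal :=
      ((ENNReal.ofReal_lt_iff_lt_toReal ht0 (hφ.2.2.2.2 y hy).ne).1 htf).le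
    have hpt : ∀ t' : ℝ, y.1 + t • y.2.vec + t' • y.2.vec = y.1 + (t + t') • y.2.vec :=
      fun t' => by rw [add_smul, add_assoc]
    rw [hp] at hza
    have := mem_blocks_of_path hΛs y.2 (ℓ := (lilyLength φ y).toReal - t) (by linarith) hz hza hs
      fun z hz t₁ t₂ h1 h2 h3 h4 => by
        rw [hpt] at h3 h4
        have := hlen y hy z hz _ _ (by linarith) (by linarith) h3 h4
        linarith [hΛ z hz]
    rwa [hpt, add_sub_cancel] at this

end

/-! ### Assembly, with `L = s ^ α` -/

theorem mainTheorem7 (lam : ℝ) (hlam : 0 < lam) (α : ℝ) (hα : 0 < α) :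
    ∃ A : ℝ → Set (Config 2 Dir),
      (∀ s, MeasurableSet (A s)) ∧
      HighProbability.{u} lam 1 A ∧
      (∀ s : ℝ, 1 ≤ s → ∀ φ ψ : Config 2 Dir, φ.carrier ⊆ markedBox 2 Dir s → φ ∈ A s →
        ψ.carrier ⊆ (markedBox 2 Dir s)ᶜ → φ.union ψ ∈ lilyConfigs →
        ∀ x ∈ (φ.union ψ).carrier,
          μH[1] (lilySegment (φ.union ψ) x ∩ box 2 s) ≤ ENNReal.ofReal (s ^ α)) ∧
      (α < 1 / 2 → ∃ A' : ℝ → Set (Config 2 Dir),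
        (∀ s, A' s = {φ | φ.restrict (markedBox 2 Dir s) ∈ A s}) ∧
        (∀ s, MeasurableSet (A' s)) ∧
        HighProbability.{u} lam 3 A' ∧
        ShieldingCondition lilyConfigs combDesc geomDesc A') := by
  have hprob : ∀ c : ℝ, 1 ≤ c →
      HighProbability.{u} lam c fun s => barrierEvent s (s ^ α) := by
    intro c hc Ω _ P _ X hX
    refine (tendsto_measure_barrierEvent hlam hα P X hX).congr' ?_
    filter_upwards [eventually_ge_atTop (0 : ℝ)] with s hs
    simp only [restrict_mem_barrierEvent (by nlinarith : s ≤ c * s)]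
  refine ⟨fun s => barrierEvent s (s ^ α), fun s => measurableSet_barrierEvent _ _,
    hprob 1 le_rfl, ?_, fun hα' => ⟨fun s => barrierEvent s (s ^ α), fun s => ?_,
      fun s => measurableSet_barrierEvent _ _, hprob 3 (by norm_num), ?_⟩⟩
  · intro s _ φ ψ _ hφ hψ hN x hx
    exact hausdorffMeasure_lilySegment_le hφ hψ hN hx
  · ext φ
    exact (restrict_mem_barrierEvent le_rfl φ).symm
  -- The bound on `α` enters only through `s ^ α < s`.
  · refine shieldingCondition_barrierEvent (L := fun s => s ^ α) fun s hs => ?_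
    calc s ^ α < s ^ (1 : ℝ) := Real.rpow_lt_rpow_of_exponent_lt (by linarith) (by linarith)
      _ = s := Real.rpow_one s
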